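/- Fix $T>0$. An input of the perfect one-cold Poisson channel (perfect OCPC) of duration $T$ is a measurable function $x:[0,T]\to\{1,2,\ldots\}$; given $x$, the output is a sequence of independent Poisson counting processes $Y=(Y_i(t))_{t\in[0,T]}$, $i=1,2,\ldots$, where $Y_i$ has intensity $\mathbf 1\{x(t)\neq i\}$ at time $t$. Let $P_{Y|X}(\cdot|x)$ be the law of the output. A simulation scheme with $\mathsf M\in\{1,2,\ldots\}$ messages and unlimited common randomness consists of a random element $W$ (with arbitrary law) shared by an encoder and a decoder, an encoder $K=f(W,x)\in\{1,\ldots,\mathsf M\}$ and a decoder $\hat Y=g(W,K)$. It simulates the channel within $\epsilon$ if for every input $x$ the total variation distance between the law of $g(W,f(W,x))$ and $P_{Y|X}(\cdot|x)$ is at most $\epsilon$. Let $\mathsf M^*_{\mathrm{sim}}(\infty,0,T,\epsilon)$ be the smallest $\mathsf M\ge 1$ for which some scheme with $\mathsf M$ messages simulates the perfect OCPC of duration $T$ within $\epsilon$, and let $\epsilon^*_{\mathrm{sim}}(\infty,0,T,\mathsf M):=\inf\{\epsilon\ge0:\mathsf M^*_{\mathrm{sim}}(\infty,0,T,\epsilon)\le\mathsf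 M\}$. Theorem. For every $T>0$ and every integer $\mathsf M\ge1$, \[ \epsilon^*_{\mathrm{sim}}(\infty,0,T,\mathsf M)\le(1-e^{-T})^{\mathsf M}\le\exp(-e^{-T}\mathsf M). \] As a result, for every $0<\epsilon<1$, $\mathsf M^*_{\mathrm{sim}}(\infty,0,T,\epsilon)$ is finite and \[ \ln\mathsf M^*_{\mathrm{sim}}(\infty,0,T,\epsilon)\le\max\{T+\ln\ln(1/\epsilon)+\ln2,\,0\}. \] In particular $\ln\mathsf M^*_{\mathrm{sim}}(\infty,0,T,\epsilon)\le T+\ln\ln(1/\epsilon)+\ln 2$ whenever the right-hand side is nonnegative, e.g. for all $0<\epsilon\le e^{-1/2}$. -/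

import Mathlib

open MeasureTheory ProbabilityTheory Set
open scoped NNReal ENNReal

noncomputable section

namespace OCPC

/-- The set of bands `[L] = {1, …, L}`; for `L = ⊤` this is `{1, 2, 3, …}`. -/
abbrev Band (L : ℕ∞) : Type := {i : ℕ // 1 ≤ i ∧ (i : ℕ∞) ≤ L}

/-- Channel inputs: measurable functions `x : [0,T] → [L]`. -/
abbrev Input (L : ℕ∞) (T : ℝ) : Type := {x : Icc (0 : ℝ) T → Band L // Measurable x}

/-- Paths of counting processes on `[0,T]`: nondecreasing right-continuous functions
`[0,T] → {0, 1, 2, …}` that start at `0`. The σ-algebra is the one generated by the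
evaluations `y ↦ y t`. -/
abbrev CountingPath (T : ℝ) : Type :=
  {y : Icc (0 : ℝ) T → ℕ //
    (∀ t : Icc (0 : ℝ) T, (t : ℝ) = 0 → y t = 0) ∧ Monotone y ∧
      ∀ t, ContinuousWithinAt y (Ici t) t}

/-- Channel outputs: one counting path for every band, with the product σ-algebra. -/
abbrev Output (L : ℕ∞) (T : ℝ) : Type := Band L → CountingPath T

/-- The intensity `1 - (1 - α) 𝟏{x(τ) = i}` of the process in band `i` at time `τ`. -/
def intensity {L : ℕ∞} {T : ℝ} (α : ℝ≥0) (x : Input L T) (i : Band L)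
    (τ : Icc (0 : ℝ) T) : ℝ :=
  1 - (1 - (α : ℝ)) * (if x.1 τ = i then 1 else 0)

/-- The mean number of points in band `i` between the times `s` and `t`, namely
`∫_s^t (1 - (1 - α) 𝟏{x(τ) = i}) dτ`. -/
def mean {L : ℕ∞} {T : ℝ} (α : ℝ≥0) (x : Input L T) (i : Band L)
    (s t : Icc (0 : ℝ) T) : ℝ≥0 :=
  (∫ τ in Ioc s t, intensity α x i τ ∂(volume.comap Subtype.val)).toNNReal

/-- `Q` is the conditional law of the output of the `(L, α)`-OCPC with duration `T` given the
input `x`: under `Q` the processes `Y_i`, `i ∈ [L]`, are independent, and each `Y_i` is a Poisson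
counting process with intensity function `τ ↦ 1 - (1 - α) 𝟏{x(τ) = i}`. -/
structure IsChannelLaw {L : ℕ∞} {T : ℝ} (α : ℝ≥0) (x : Input L T)
    (Q : Measure (Output L T)) : Prop where
  isProbabilityMeasure : IsProbabilityMeasure Q
  iIndepFun_band : iIndepFun (fun (i : Band L) (y : Output L T) => y i) Q
  indep_increments : ∀ i : Band L,
    HasIndepIncrements (fun (t : Icc (0 : ℝ) T) (y : Output L T) => (y i).1 t) Q
  increment_law : ∀ (i : Band L) (s t : Icc (0 : ℝ) T), s < t →
    HasLaw (fun y : Output L T => (y i).1 t - (y i).1 s) (poissonMeasure (mean α x i s t)) Q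

/-- Total variation distance `sup_A |P(A) - Q(A)|` over measurable sets `A`
(for probability measures `P`, `Q`). -/
def tvDist {Y : Type*} [MeasurableSpace Y] (P Q : Measure Y) : ℝ :=
  ⨆ A : {A : Set Y // MeasurableSet A}, |P.real A.1 - Q.real A.1|

/-- A channel simulation scheme with unlimited common randomness and `M` messages:
the common randomness `w` with an arbitrary law, the encoder `(w, x) ↦ k = f(w, x) ∈ [M]` and the
decoder `(w, k) ↦ ŷ = g(w, k)`. -/
structure SimScheme (L : ℕ∞) (T : ℝ) (M : ℕ) where
  /-- the space of the common randomness -/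
  W : Type
  [measurableSpace : MeasurableSpace W]
  /-- the law of the common randomness -/
  law : Measure W
  [isProbabilityMeasure : IsProbabilityMeasure law]
  /-- the encoder -/
  f : W → Input L T → Fin M
  measurable_f : ∀ x, Measurable (fun w => f w x)
  /-- the decoder -/
  g : W → Fin M → Output L T
  measurable_g : ∀ k, Measurable (fun w => g w k)

attribute [instance] SimScheme.measurableSpace SimScheme.isProbabilityMeasure

/-- The law of the simulated output `ŷ = g(w, f(w, x))` given the input `x`. -/
def SimScheme.outputLaw {L : ℕ∞} {T : ℝ} {M : ℕ} (S : SimScheme L T M) (x : Input L T) :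
    Measure (Output L T) :=
  S.law.map (fun w => S.g w (S.f w x))

/-- The `(L, α)`-OCPC with duration `T` can be simulated with `M` messages within total variation
distance `ε`, for every input `x`. -/
def Simulable (L : ℕ∞) (α : ℝ≥0) (T : ℝ) (M : ℕ) (ε : ℝ) : Prop :=
  ∃ S : SimScheme L T M, ∀ x : Input L T, ∃ Q : Measure (Output L T),
    IsChannelLaw α x Q ∧ tvDist (S.outputLaw x) Q ≤ ε

/-- `M*_sim(L, α, T, ε)`: the smallest `M ∈ {1, 2, …}` such that the channel can be simulated with
`M` messages within total variation distance `ε` (and `⊤` if there is none). -/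
def Msim (L : ℕ∞) (α : ℝ≥0) (T : ℝ) (ε : ℝ) : ℕ∞ :=
  ⨅ (M : ℕ) (_ : 1 ≤ M ∧ Simulable L α T M ε), (M : ℕ∞)

/-- `ε*_sim(L, α, T, M) = inf {ε ≥ 0 : M*_sim(L, α, T, ε) ≤ M}`, as an extended nonnegative
number (the infimum of the empty set is `⊤`). -/
def epsSim (L : ℕ∞) (α : ℝ≥0) (T : ℝ) (M : ℕ) : ℝ≥0∞ :=
  ⨅ (ε : ℝ≥0) (_ : Msim L α T ε ≤ M), (ε : ℝ≥0∞)

end OCPC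

end

/-! The scheme is rejection sampling. The common randomness is `M` independent samples, each
consisting of independent rate-one Poisson processes in all bands. Given `x`, a sample is accepted
if band `i` has no point at any time when `x = i`.

Deleting the blocked times from a Poisson process has the same effect on its law as conditioning on
a void there, so an accepted sample has exactly the channel law (`isChannelLaw_cond_accept`). The
level sets of `x` partition `[0,T]`, so the void probabilities multiply to `e^{-T}` for every `x`
(`sampleLaw_accept`), even with infinitely many bands. The encoder sends the index of the first
accepted sample; the output law can err only when all `M` samples are rejected, which has
probability `(1 - e^{-T})^M` (`abs_firstIndex_sub_cond_le`). The bound on the number of messages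
follows by taking `M = ⌈e^T ln(1/ε)⌉`. -/

noncomputable section

namespace OCPC

/-! ### Finite Poisson point processes conditioned on a void -/

section PoissonPoints

variable {E : Type*}

/-- The number of points in `C`. -/
def count (C : Set E) (ω : ℕ × (ℕ → E)) : ℕ :=
  ∑ j ∈ Finset.range ω.1, C.indicator 1 (ω.2 j)

/-- The event that no point lies in `B`. -/
def avoid (B : Set E) : Set (ℕ × (ℕ → E)) := {ω | ∀ j < ω.1, ω.2 j ∉ B}

lemma count_union {C D : Set E} (h : Disjoint C D) (ω : ℕ × (ℕ → E)) :
    count (C ∪ D) ω = count C ω + count D ω := by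
  simp [count, Set.indicator_union_of_disjoint h, Finset.sum_add_distrib]

lemma norm_prod_points_le {h : E → ℂ} (h1 : ∀ u, ‖h u‖ ≤ 1) (ω : ℕ × (ℕ → E)) :
    ‖∏ j ∈ Finset.range ω.1, h (ω.2 j)‖ ≤ 1 := by
  rw [norm_prod]
  exact Finset.prod_le_one (fun _ _ => norm_nonneg _) fun j _ => h1 _

/-- Makes the void event multiplicative over the points, so that the generating functional applies
to it. -/
lemma indicator_avoid (B : Set E) (ω : ℕ × (ℕ → E)) :
    (avoid B).indicator (1 : ℕ × (ℕ → E) → ℂ) ω =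
      ∏ j ∈ Finset.range ω.1, Bᶜ.indicator (1 : E → ℂ) (ω.2 j) := by
  by_cases h : ω ∈ avoid B
  · rw [indicator_of_mem h, Finset.prod_eq_one]
    · rfl
    · intro j hj
      rw [indicator_of_mem (h j (Finset.mem_range.1 hj))]
      rfl
  · rw [indicator_of_notMem h]
    simp only [avoid, mem_ofPred_eq, not_forall, not_not] at h
    obtain ⟨j, hj, hjB⟩ := h
    exact (Finset.prod_eq_zero (Finset.mem_range.2 hj) (indicator_of_notMem (not_not_intro hjB) _)).symm

variable [MeasurableSpace E]

/-- The law of a Poisson number of independent points: the first coordinate is the number of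
points, and only that many entries of the sequence in the second coordinate count. -/
def poissonPoints (r : ℝ≥0) (P : Measure E) [IsProbabilityMeasure P] : Measure (ℕ × (ℕ → E)) :=
  (poissonMeasure r).prod (Measure.infinitePi fun _ => P)

instance (r : ℝ≥0) (P : Measure E) [IsProbabilityMeasure P] :
    IsProbabilityMeasure (poissonPoints r P) := by
  unfold poissonPoints; infer_instance

lemma measurable_count {C : Set E} (hC : MeasurableSet C) : Measurable (count C) := by
  refine measurable_from_prod_countable_right fun n => ?_
  exact Finset.measurable_sum (f := fun j (u : ℕ → E) => C.indicator (1 : E → ℕ) (u j)) (Finset.range n)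
    fun j _ => (measurable_one.indicator hC).comp (measurable_pi_apply j)

lemma measurableSet_avoid {B : Set E} (hB : MeasurableSet B) : MeasurableSet (avoid B) := by
  have : avoid B = count B ⁻¹' {0} := by
    ext ω
    simp [avoid, count]
  rw [this]
  exact measurable_count hB (measurableSet_singleton 0)

lemma measurable_prod_points {h : E → ℂ} (hm : Measurable h) :
    Measurable (fun ω : ℕ × (ℕ → E) => ∏ j ∈ Finset.range ω.1, h (ω.2 j)) := by
  refine measurable_from_prod_countable_right fun n => ?_
  exact Finset.measurable_prod (f := fun j (u : ℕ → E) => h (u j)) (Finset.range n)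
    fun j _ => hm.comp (measurable_pi_apply j)

variable (r : ℝ≥0) (P : Measure E) [IsProbabilityMeasure P]

lemma integral_indicator_one_complex {D : Set E} (hD : MeasurableSet D) {P : Measure E} :
    ∫ u, D.indicator (1 : E → ℂ) u ∂P = P.real D := by
  rw [integral_indicator hD]
  simp

lemma integral_prod_iid {h : E → ℂ} (hm : Measurable h) (n : ℕ) :
    ∫ u : ℕ → E, ∏ j ∈ Finset.range n, h (u j) ∂(Measure.infinitePi fun _ => P) =
      (∫ u, h u ∂P) ^ n := by
  have hind : iIndepFun (fun (j : Fin n) (u : ℕ → E) => h (u j))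
      (Measure.infinitePi fun _ => P) :=
    (iIndepFun_infinitePi (P := fun _ : ℕ => P) (X := fun _ => h) fun _ => hm).precomp
      Fin.val_injective
  have := hind.integral_fun_prod_eq_prod_integral fun j =>
    (hm.comp (measurable_pi_apply _)).aestronglyMeasurable
  simp_rw [Finset.prod_range]
  rw [this]
  have h2 (j : ℕ) : ∫ u : ℕ → E, h (u j) ∂(Measure.infinitePi fun _ => P) = ∫ u, h u ∂P := by
    conv_rhs => rw [← Measure.infinitePi_map_eval (fun _ : ℕ => P) j]
    rw [integral_map (measurable_pi_apply j).aemeasurable hm.aestronglyMeasurable]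
  simp [h2]

/-- The probability generating functional of a Poisson number of independent points. -/
lemma integral_prod_poissonPoints {h : E → ℂ} (hm : Measurable h) (h1 : ∀ u, ‖h u‖ ≤ 1) :
    ∫ ω, ∏ j ∈ Finset.range ω.1, h (ω.2 j) ∂(poissonPoints r P) =
      Complex.exp (r * ((∫ u, h u ∂P) - 1)) := by
  have hint : Integrable (fun ω : ℕ × (ℕ → E) => ∏ j ∈ Finset.range ω.1, h (ω.2 j))
      (poissonPoints r P) :=
    Integrable.of_bound (measurable_prod_points hm).aestronglyMeasurable 1
      (ae_of_all _ (norm_prod_points_le h1))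
  rw [poissonPoints] at hint ⊢
  rw [integral_prod _ hint]
  simp_rw [integral_prod_iid P hm]
  set z := ∫ u, h u ∂P
  rw [integral_poissonMeasure]
  calc ∑' a : ℕ, (Real.exp (-r) * r ^ a / a.factorial : ℝ) • z ^ a
      = ∑' a : ℕ, (Real.exp (-r) : ℂ) * ((r * z) ^ a / a.factorial) := by
        congr with a
        rw [Complex.real_smul]
        push_cast
        ring
    _ = (Real.exp (-r) : ℂ) * ∑' a : ℕ, ((r * z) ^ a / a.factorial) := tsum_mul_left
    _ = Real.exp (-r) * Complex.exp (r * z) := by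
        rw [(NormedSpace.expSeries_div_hasSum_exp ((r : ℂ) * z)).tsum_eq, Complex.exp_eq_exp_ℂ]
    _ = Complex.exp (r * (z - 1)) := by
        rw [Complex.ofReal_exp, ← Complex.exp_add]
        push_cast
        ring_nf

lemma poissonPoints_real_avoid {B : Set E} (hB : MeasurableSet B) :
    (poissonPoints r P).real (avoid B) = Real.exp (-(r * P.real B)) := by
  have h1 := integral_prod_poissonPoints r P (h := Bᶜ.indicator 1)
    (measurable_one.indicator hB.compl) fun u => by
      by_cases hu : u ∈ Bᶜ <;> simp [hu]
  simp_rw [← indicator_avoid] at h1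
  rw [integral_indicator_one_complex (measurableSet_avoid hB),
    integral_indicator_one_complex hB.compl,
    probReal_compl_eq_one_sub hB] at h1
  rw [← Complex.ofReal_inj, h1]
  push_cast
  ring_nf

lemma poissonPoints_avoid_ne_zero {B : Set E} (hB : MeasurableSet B) :
    poissonPoints r P (avoid B) ≠ 0 := by
  intro h
  have := poissonPoints_real_avoid r P hB
  rw [Measure.real, h] at this
  exact (Real.exp_pos _).ne this

/-- The counts of disjoint sets, conditioned on the absence of points in `B`: joint characteristic
function. -/
lemma integral_cond_avoid {ι : Type*} [Fintype ι] {C : ι → Set E} {B : Set E}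
    (hC : ∀ l, MeasurableSet (C l)) (hd : Pairwise (Function.onFun Disjoint C))
    (hB : MeasurableSet B) (s : ι → ℝ) :
    ∫ ω, Complex.exp ((∑ l, s l * count (C l) ω : ℝ) * Complex.I) ∂(poissonPoints r P)[|avoid B] =
      ∏ l, Complex.exp ((r * P.real (C l \ B) : ℝ) * (Complex.exp (s l * Complex.I) - 1)) := by
  classical
  have hA := measurableSet_avoid hB
  set g : E → ℂ := fun u => Complex.exp ((∑ l, s l * (C l).indicator 1 u : ℝ) * Complex.I) with hg
  have hgm : Measurable g := by
    have : Measurable fun u => ∑ l, s l * (C l).indicator (1 : E → ℝ) u :=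
      Finset.measurable_sum _ fun l _ => (measurable_one.indicator (hC l)).const_mul _
    fun_prop
  set h : E → ℂ := fun u => Bᶜ.indicator 1 u * g u with hh
  have hhm : Measurable h := (measurable_one.indicator hB.compl).mul hgm
  have hprod (ω : ℕ × (ℕ → E)) :
      -- Restricting to the void event keeps the integrand a product over points: the factor `h`
      -- vanishes on `B`.
      (avoid B).indicator
        (fun ω => Complex.exp ((∑ l, s l * count (C l) ω : ℝ) * Complex.I)) ω =
      ∏ j ∈ Finset.range ω.1, h (ω.2 j) := by
    rw [hh, Finset.prod_mul_distrib, ← indicator_avoid]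
    have h1 : ∏ j ∈ Finset.range ω.1, g (ω.2 j) =
        Complex.exp ((∑ l, s l * count (C l) ω : ℝ) * Complex.I) := by
      rw [hg, ← Complex.exp_sum, ← Finset.sum_mul]
      congr 2
      rw [← Complex.ofReal_sum, Finset.sum_comm]
      congr 1
      refine Finset.sum_congr rfl fun l _ => ?_
      rw [count, ← Finset.mul_sum, Nat.cast_sum]
      congr 1
      refine Finset.sum_congr rfl fun j _ => ?_
      by_cases hj : ω.2 j ∈ C l <;> simp [hj]
    rw [h1]
    by_cases hω : ω ∈ avoid B <;> simp [hω]
  have hh1 (u : E) : ‖h u‖ ≤ 1 := by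
    rw [hh, norm_mul, hg, Complex.norm_exp_ofReal_mul_I, mul_one]
    by_cases hu : u ∈ Bᶜ <;> simp [hu]
  -- By disjointness at most one `C l` contains `u`, so the exponential of the sum becomes linear in
  -- the indicators.
  have hexp (u : E) : h u = Bᶜ.indicator 1 u +
      ∑ l, (C l \ B).indicator 1 u * (Complex.exp (s l * Complex.I) - 1) := by
    by_cases hu : u ∈ B
    · simp [hh, hu]
    by_cases hl : ∃ l, u ∈ C l
    · obtain ⟨l, hl⟩ := hl
      have hne (m : ι) (hm : m ≠ l) : u ∉ C m := fun hmu =>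
        (Set.disjoint_left.1 (hd hm)) hmu hl
      rw [Finset.sum_eq_single l (fun m _ hm => by simp [hne m hm]) (by simp)]
      have : ∑ m, s m * (C m).indicator (1 : E → ℝ) u = s l := by
        rw [Finset.sum_eq_single l (fun m _ hm => by simp [hne m hm]) (by simp)]
        simp [hl]
      simp only [hh, hg, this]
      simp [hu, hl]
    · push Not at hl
      simp [hh, hg, hu, hl]
  have hinth : ∫ u, h u ∂P = 1 - P.real B +
      ∑ l, P.real (C l \ B) * (Complex.exp (s l * Complex.I) - 1) := by
    have hi (D : Set E) (hD : MeasurableSet D) : Integrable (D.indicator (1 : E → ℂ)) P :=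
      (integrable_const (1 : ℂ)).indicator hD
    simp_rw [hexp]
    rw [integral_add (hi _ hB.compl) (integrable_finsetSum _ fun l _ =>
      (hi _ ((hC l).diff hB)).mul_const _), integral_finsetSum _ fun l _ =>
      (hi _ ((hC l).diff hB)).mul_const _, integral_indicator_one_complex hB.compl,
      probReal_compl_eq_one_sub hB]
    congr 1
    · push_cast; rfl
    · refine Finset.sum_congr rfl fun l _ => ?_
      rw [integral_mul_const, integral_indicator_one_complex ((hC l).diff hB)]
  have hmain := integral_prod_poissonPoints r P hhm hh1
  simp_rw [← hprod] at hmain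
  rw [integral_indicator hA] at hmain
  -- Dividing by the void probability `e^{-rP(B)}` cancels the term `-P(B)` in `∫ h - 1`.
  rw [ProbabilityTheory.cond, integral_smul_measure, hmain, hinth, ENNReal.toReal_inv,
    ← Measure.real, poissonPoints_real_avoid r P hB, ← Complex.exp_sum, Complex.real_smul,
    ← Real.exp_neg, Complex.ofReal_exp, ← Complex.exp_add]
  congr 1
  push_cast
  simp_rw [mul_assoc, ← Finset.mul_sum]
  ring

lemma charFun_count_cond_avoid {C B : Set E} (hC : MeasurableSet C) (hB : MeasurableSet B)
    (s : ℝ) : charFun ((poissonPoints r P)[|avoid B].map fun ω => (count C ω : ℝ)) s =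
      Complex.exp ((r * P.real (C \ B) : ℝ) * (Complex.exp (s * Complex.I) - 1)) := by
  have hm : Measurable fun ω => (count C ω : ℝ) := measurable_from_nat.comp (measurable_count hC)
  have := integral_cond_avoid r P (ι := Unit) (C := fun _ => C) (fun _ => hC)
    (fun a b hab => (hab (Subsingleton.elim _ _)).elim) hB (fun _ => s)
  rw [charFun_apply, integral_map hm.aemeasurable (by fun_prop)]
  simpa [mul_comm] using this

lemma map_count_cond_avoid {C B : Set E} (hC : MeasurableSet C) (hB : MeasurableSet B)
    {m : ℝ≥0} (hm : (m : ℝ) = r * P.real (C \ B)) :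
    (poissonPoints r P)[|avoid B].map (count C) = poissonMeasure m := by
  have : IsProbabilityMeasure (poissonPoints r P)[|avoid B] :=
    cond_isProbabilityMeasure (poissonPoints_avoid_ne_zero r P hB)
  have : IsProbabilityMeasure ((poissonPoints r P)[|avoid B].map (count C)) :=
    Measure.isProbabilityMeasure_map (measurable_count hC).aemeasurable
  have hcast : Measurable (Nat.cast : ℕ → ℝ) := measurable_from_nat
  have key : ((poissonPoints r P)[|avoid B].map (count C)).map (Nat.cast : ℕ → ℝ) =
      (poissonMeasure m).map (Nat.cast : ℕ → ℝ) := by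
    have := Measure.isProbabilityMeasure_map (μ := (poissonPoints r P)[|avoid B].map (count C))
      hcast.aemeasurable
    apply Measure.ext_of_charFun
    ext s
    rw [Measure.map_map hcast (measurable_count hC), charFun_map_cast_poissonMeasure]
    have := charFun_count_cond_avoid r P hC hB s
    rw [← hm] at this
    exact this
  -- Characteristic functions live on `ℝ`; the floor is a measurable left inverse of the cast and
  -- brings the identity back to `ℕ`.
  have hfl : Measurable (fun x : ℝ => ⌊x⌋₊) := Nat.measurable_floor
  have h2 := congrArg (fun ν => Measure.map (fun x : ℝ => ⌊x⌋₊) ν) key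
  simp only [Measure.map_map hfl hcast] at h2
  have h3 : (fun x : ℝ => ⌊x⌋₊) ∘ (Nat.cast : ℕ → ℝ) = id := by ext; simp
  simpa [h3] using h2

lemma iIndepFun_count_cond_avoid {ι : Type*} [Fintype ι] {C : ι → Set E} {B : Set E}
    (hC : ∀ l, MeasurableSet (C l)) (hd : Pairwise (Function.onFun Disjoint C))
    (hB : MeasurableSet B) :
    iIndepFun (fun l => count (C l)) (poissonPoints r P)[|avoid B] := by
  have : IsProbabilityMeasure (poissonPoints r P)[|avoid B] :=
    cond_isProbabilityMeasure (poissonPoints_avoid_ne_zero r P hB)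
  have hm (l : ι) : Measurable fun ω => (count (C l) ω : ℝ) :=
    measurable_from_nat.comp (measurable_count (hC l))
  have key : iIndepFun (fun l ω => (count (C l) ω : ℝ)) (poissonPoints r P)[|avoid B] := by
    rw [iIndepFun_iff_charFun_pi fun l => (hm l).aemeasurable]
    intro s
    simp_rw [charFun_count_cond_avoid r P (hC _) hB]
    have hmL : Measurable fun ω => WithLp.toLp 2 fun l => (count (C l) ω : ℝ) :=
      (WithLp.measurable_toLp 2 (ι → ℝ)).comp (measurable_pi_lambda _ hm)
    rw [← integral_cond_avoid r P hC hd hB, charFun_apply, integral_map hmL.aemeasurable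
      (by fun_prop)]
    simp [PiLp.inner_apply]
  have := key.comp (fun _ x => ⌊x⌋₊) fun _ => Nat.measurable_floor
  simpa [Function.comp_def] using this

end PoissonPoints

/-! ### Conditioning infinite products -/

section Conditioning

open Filter Topology

/-- Conditioning a product measure on a box of positive measure conditions every factor. -/
lemma infinitePi_cond_univ_pi {ι : Type*} [Countable ι] {X : ι → Type*}
    [∀ i, MeasurableSpace (X i)] (μ : ∀ i, Measure (X i)) [∀ i, IsProbabilityMeasure (μ i)]
    {A : ∀ i, Set (X i)} (hA : ∀ i, MeasurableSet (A i))
    [∀ i, IsProbabilityMeasure (μ i)[|A i]] (hne : Measure.infinitePi μ (univ.pi A) ≠ 0) :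
    (Measure.infinitePi μ)[|univ.pi A] = Measure.infinitePi fun i => (μ i)[|A i] := by
  classical
  have h0 (i : ι) : μ i (A i) ≠ 0 := fun h =>
    IsProbabilityMeasure.ne_zero (μ i)[|A i] (cond_eq_zero_of_meas_eq_zero h)
  refine Measure.eq_infinitePi _ fun s t ht => ?_
  rw [cond_apply (MeasurableSet.univ_pi hA)]
  simp_rw [cond_apply (hA _)]
  set f : ι → ℝ≥0∞ := fun i => μ i (A i) with hf
  set g : ι → ℝ≥0∞ := fun i => if i ∈ s then μ i (A i ∩ t i) else μ i (A i) with hg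
  have hset : univ.pi A ∩ (s : Set ι).pi t =
      univ.pi fun i => if i ∈ s then A i ∩ t i else A i := by
    ext x
    simp only [mem_inter_iff, Set.mem_pi, mem_univ, true_imp_iff, Finset.mem_coe]
    refine ⟨fun ⟨h1, h2⟩ i => ?_, fun h => ⟨fun i => ?_, fun i hi => ?_⟩⟩
    · split_ifs with hi
      exacts [⟨h1 i, h2 i hi⟩, h1 i]
    · have := h i
      split_ifs at this with hi
      exacts [this.1, this]
    · have := h i
      rw [if_pos hi] at this
      exact this.2
  have hf1 : HasProd f (Measure.infinitePi μ (univ.pi A)) := by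
    rw [Measure.infinitePi_pi_univ μ hA, ENNReal.tprod_eq_iInf_prod fun i => prob_le_one]
    exact ENNReal.hasProd_iInf_prod fun i => prob_le_one
  have hg1 : HasProd g (Measure.infinitePi μ (univ.pi A ∩ (s : Set ι).pi t)) := by
    have hle (i : ι) : g i ≤ 1 := by simp only [hg]; split_ifs <;> exact prob_le_one
    have hgi (i : ι) : μ i (if i ∈ s then A i ∩ t i else A i) = g i := by
      simp only [hg]; split_ifs <;> rfl
    rw [hset, Measure.infinitePi_pi_univ μ fun i => by
      split_ifs
      exacts [(hA i).inter (ht i), hA i]]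
    simp_rw [hgi]
    rw [ENNReal.tprod_eq_iInf_prod hle]
    exact ENNReal.hasProd_iInf_prod hle
  have hfin (F : Finset ι) (k : ι → ℝ≥0∞) (hk : ∀ i, k i ≤ 1) : ∏ i ∈ F, k i ≠ ∞ :=
    ENNReal.prod_ne_top fun i _ => ((hk i).trans_lt ENNReal.one_lt_top).ne
  have hpf : ∏ i ∈ s, f i ≠ ∞ := hfin s f fun i => prob_le_one
  have hpg : ∏ i ∈ s, μ i (A i ∩ t i) ≠ ∞ := hfin s _ fun i => prob_le_one
  have hlim1 := ENNReal.Tendsto.const_mul (hg1 : Tendsto _ _ _) (Or.inr hpf)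
  have hlim2 := ENNReal.Tendsto.const_mul (hf1 : Tendsto _ _ _) (Or.inr hpg)
  -- The two infinite products differ only on `s`. Cross-multiplying by the finite products over `s`
  -- makes the partial products agree once `F ⊇ s`, and avoids dividing before the limit.
  have heq := tendsto_nhds_unique_of_eventuallyEq hlim1 hlim2 (by
    simp only [SummationFilter.unconditional_filter]
    filter_upwards [eventually_ge_atTop s] with F hF
    rw [← Finset.prod_sdiff hF, ← Finset.prod_sdiff (f := f) hF,
      Finset.prod_congr rfl (fun i hi => show g i = f i from if_neg (Finset.mem_sdiff.1 hi).2),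
      Finset.prod_congr rfl
        (fun i hi => show g i = μ i (A i ∩ t i) from if_pos (by exact hi))]
    ring)
  rw [Finset.prod_mul_distrib, ← ENNReal.prod_inv_distrib
    (fun i _ _ _ _ => Or.inl (h0 i))]
  have hp0 : ∏ i ∈ s, f i ≠ 0 := Finset.prod_ne_zero_iff.2 fun i _ => h0 i
  rw [← ENNReal.div_eq_inv_mul, ← ENNReal.div_eq_inv_mul, ENNReal.div_eq_div_iff hp0 hpf hne
    (measure_ne_top _ _), heq, mul_comm]

lemma iIndepFun_map_iff {Ω Ω' ι : Type*} [Fintype ι] {β : ι → Type*} [MeasurableSpace Ω]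
    [MeasurableSpace Ω'] [∀ i, MeasurableSpace (β i)] {P : Measure Ω} [IsProbabilityMeasure P]
    {φ : Ω → Ω'} (hφ : Measurable φ) {X : ∀ i, Ω' → β i} (hX : ∀ i, Measurable (X i)) :
    iIndepFun X (P.map φ) ↔ iIndepFun (fun i ω => X i (φ ω)) P := by
  have := Measure.isProbabilityMeasure_map (μ := P) hφ.aemeasurable
  have hX' (i : ι) : Measurable fun ω => X i (φ ω) := (hX i).comp hφ
  rw [iIndepFun_iff_map_fun_eq_pi_map fun i => (hX i).aemeasurable,
    iIndepFun_iff_map_fun_eq_pi_map fun i => (hX' i).aemeasurable,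
    Measure.map_map (by fun_prop) hφ]
  simp_rw [Measure.map_map (hX _) hφ]
  rfl

end Conditioning

/-! ### Rejection sampling with finitely many samples -/

section Rejection

variable {Ω : Type*} {M : ℕ}

/-- The event that the first sample in `A` is the one with index `k`. -/
def firstHit (A : Set Ω) (k : Fin M) : Set (Fin M → Ω) :=
  univ.pi fun j => if j < k then Aᶜ else if j = k then A else univ

lemma mem_firstHit {A : Set Ω} {k : Fin M} {w : Fin M → Ω} :
    w ∈ firstHit A k ↔ w k ∈ A ∧ ∀ j < k, w j ∉ A := by
  simp only [firstHit, mem_univ_pi]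
  refine ⟨fun h => ⟨by simpa using h k, fun j hj => by simpa [hj] using h j⟩, fun h j => ?_⟩
  rcases lt_trichotomy j k with hj | rfl | hj
  · simpa [hj] using h.2 j hj
  · simpa using h.1
  · simp [hj.ne', hj.not_gt]

lemma firstHit_unique {A : Set Ω} {k l : Fin M} {w : Fin M → Ω} (hk : w ∈ firstHit A k)
    (hl : w ∈ firstHit A l) : k = l := by
  rw [mem_firstHit] at hk hl
  rcases lt_trichotomy k l with h | h | h
  · exact (hl.2 k h hk.1).elim
  · exact h
  · exact (hk.2 l h hl.1).elim

lemma exists_firstHit {A : Set Ω} {w : Fin M → Ω} (h : ∃ k, w k ∈ A) : ∃ k, w ∈ firstHit A k := by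
  obtain ⟨k, hk, hmin⟩ := WellFounded.has_min (wellFounded_lt (α := Fin M)) {k | w k ∈ A} h
  exact ⟨k, mem_firstHit.2 ⟨hk, fun j hj hA => hmin j hA hj⟩⟩

open Classical in
/-- The index of the first sample in `A`, and the default `k₀` if there is none. -/
def firstIndex (k₀ : Fin M) (A : Set Ω) (w : Fin M → Ω) : Fin M :=
  if h : ∃ k, w ∈ firstHit A k then h.choose else k₀

lemma firstIndex_eq {k₀ : Fin M} {A : Set Ω} {w : Fin M → Ω} {k : Fin M}
    (hk : w ∈ firstHit A k) : firstIndex k₀ A w = k := by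
  have h : ∃ k, w ∈ firstHit A k := ⟨k, hk⟩
  rw [firstIndex, dif_pos h]
  exact firstHit_unique h.choose_spec hk

variable [MeasurableSpace Ω]

lemma measurableSet_firstHit {A : Set Ω} (hA : MeasurableSet A) (k : Fin M) :
    MeasurableSet (firstHit A k) := by
  refine MeasurableSet.univ_pi fun j => ?_
  split_ifs
  exacts [hA.compl, hA, .univ]

lemma measurable_firstIndex (k₀ : Fin M) {A : Set Ω} (hA : MeasurableSet A) :
    Measurable (firstIndex k₀ A) := by
  classical
  refine measurable_to_countable' fun k => ?_
  have : firstIndex k₀ A ⁻¹' {k} =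
      firstHit A k ∪ (if k = k₀ then (⋃ l, firstHit A l)ᶜ else ∅) := by
    ext w
    simp only [mem_preimage, mem_singleton_iff, mem_union]
    by_cases h : ∃ l, w ∈ firstHit A l
    · obtain ⟨l, hl⟩ := h
      rw [firstIndex_eq hl]
      refine ⟨fun h => Or.inl (h ▸ hl), fun h => ?_⟩
      rcases h with h | h
      · exact firstHit_unique hl h
      · split_ifs at h
        exacts [(h (mem_iUnion.2 ⟨l, hl⟩)).elim, h.elim]
    · rw [firstIndex, dif_neg h]
      push Not at h
      split_ifs with hk
      · simp [hk, h]
      · simp [h, Ne.symm hk]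
  rw [this]
  refine (measurableSet_firstHit hA k).union ?_
  split_ifs
  exacts [(MeasurableSet.iUnion fun l => measurableSet_firstHit hA l).compl, .empty]

variable (μ : Measure Ω) [IsProbabilityMeasure μ]

/-- Rejection sampling from `M` independent samples: the first sample in `A` follows the
conditional law given `A` up to the probability that all samples are rejected. -/
lemma abs_firstIndex_sub_cond_le (k₀ : Fin M) {A S : Set Ω} (hA : MeasurableSet A)
    (hS : MeasurableSet S) (h0 : μ A ≠ 0) :
    |(Measure.pi fun _ : Fin M => μ).real {w | w (firstIndex k₀ A w) ∈ S} - μ[|A].real S| ≤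
      (1 - μ.real A) ^ M := by
  classical
  set ν := Measure.pi fun _ : Fin M => μ
  set p := μ.real A with hp
  have hp0 : 0 < p := ENNReal.toReal_pos h0 (measure_ne_top _ _)
  have hp1 : p ≤ 1 := measureReal_le_one
  have hbox (k : Fin M) (D : Set Ω) : ν.real (univ.pi fun j => if j < k then Aᶜ else
      if j = k then D else univ) = (1 - p) ^ (k : ℕ) * μ.real D := by
    rw [Measure.real, Measure.pi_pi, ENNReal.toReal_prod]
    have hj (j : Fin M) : (μ (if j < k then Aᶜ else if j = k then D else univ)).toReal =
        (if j < k then 1 - p else 1) * (if j = k then μ.real D else 1) := by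
      rcases lt_trichotomy j k with hj | rfl | hj
      · simp only [hj, hj.ne, if_true, if_false, mul_one]
        exact probReal_compl_eq_one_sub hA
      · simp [Measure.real]
      · simp [hj.ne', hj.not_gt]
    simp_rw [hj]
    rw [Finset.prod_mul_distrib, Finset.prod_ite_eq' Finset.univ k, Finset.prod_ite]
    have hcard : (Finset.univ.filter fun j : Fin M => j < k).card = k := by
      rw [Finset.filter_gt_eq_Iio, Fin.card_Iio]
    simp [hcard]
  set E : Fin M → Set (Fin M → Ω) := fun k =>
    univ.pi fun j => if j < k then Aᶜ else if j = k then A ∩ S else univ with hE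
  have hmemE (k : Fin M) (w : Fin M → Ω) : w ∈ E k ↔ w ∈ firstHit A k ∧ w k ∈ S := by
    rw [mem_firstHit]
    simp only [hE, mem_univ_pi]
    refine ⟨fun h => ?_, fun h j => ?_⟩
    · have hk : w k ∈ A ∩ S := by simpa using h k
      exact ⟨⟨hk.1, fun j hj => by simpa [hj] using h j⟩, hk.2⟩
    · rcases lt_trichotomy j k with hj | rfl | hj
      · simpa [hj] using h.1.2 j hj
      · simpa using ⟨h.1.1, h.2⟩
      · simp [hj.ne', hj.not_gt]
  have hEm (k : Fin M) : MeasurableSet (E k) := by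
    refine MeasurableSet.univ_pi fun j => ?_
    split_ifs
    exacts [hA.compl, hA.inter hS, .univ]
  have hEd : Pairwise (Function.onFun Disjoint E) := fun k l hkl =>
    Set.disjoint_left.2 fun w hk hl =>
      hkl (firstHit_unique ((hmemE k w).1 hk).1 ((hmemE l w).1 hl).1)
  set N : Set (Fin M → Ω) := univ.pi fun _ => Aᶜ with hN
  have hNr : ν.real N = (1 - p) ^ M := by
    rw [Measure.real, Measure.pi_pi, ENNReal.toReal_prod]
    have : (μ Aᶜ).toReal = 1 - p := probReal_compl_eq_one_sub hA
    simp [this]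
  set H := {w : Fin M → Ω | w (firstIndex k₀ A w) ∈ S} with hH
  have hsub1 : (⋃ k, E k) ⊆ H := by
    intro w hw
    obtain ⟨k, hk⟩ := mem_iUnion.1 hw
    rw [hmemE] at hk
    rw [hH, mem_ofPred_eq, firstIndex_eq hk.1]
    exact hk.2
  have hsub2 : H ⊆ (⋃ k, E k) ∪ N := by
    intro w hw
    by_cases h : ∃ k, w k ∈ A
    · obtain ⟨k, hk⟩ := exists_firstHit h
      rw [hH, mem_ofPred_eq, firstIndex_eq hk] at hw
      exact Or.inl (mem_iUnion.2 ⟨k, (hmemE k w).2 ⟨hk, hw⟩⟩)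
    · push Not at h
      exact Or.inr fun k _ => h k
  -- Geometric series: index `k` contributes `(1 - p)^k μ(A ∩ S)`.
  have hsum : ν.real (⋃ k, E k) = μ[|A].real S * (1 - (1 - p) ^ M) := by
    rw [measureReal_iUnion_fintype hEd hEm]
    simp_rw [hE, hbox]
    rw [← Finset.sum_mul, ← Finset.sum_range fun k => (1 - p) ^ k, Measure.real, Measure.real,
      cond_apply hA, ENNReal.toReal_mul, ENNReal.toReal_inv, ← mul_neg_geom_sum]
    change _ = p⁻¹ * _ * _
    field_simp
    ring
  have h1 : ν.real (⋃ k, E k) ≤ ν.real H := measureReal_mono hsub1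
  have h2 : ν.real H ≤ ν.real (⋃ k, E k) + ν.real N :=
    (measureReal_mono hsub2).trans (measureReal_union_le _ _)
  have : IsProbabilityMeasure μ[|A] := cond_isProbabilityMeasure h0
  have hq0 : 0 ≤ μ[|A].real S := measureReal_nonneg
  have hq1 : μ[|A].real S ≤ 1 := measureReal_le_one
  have hr : 0 ≤ (1 - p) ^ M := pow_nonneg (by linarith) _
  rw [hsum] at h1 h2
  rw [hNr] at h2
  -- With `q = μ[S | A]` and `r = (1 - p)^M`, the probability of `H` lies between `q(1 - r)` and
  -- `q(1 - r) + r`; since `0 ≤ q ≤ 1`, it is within `r` of `q`.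
  rw [abs_le]
  constructor <;> nlinarith

end Rejection

/-! ### From point configurations to counting paths -/

section Paths

open Filter Topology

variable {T : ℝ}

/-- The counting path of a configuration of points in `[0,T]`; a point at `0` is ignored. -/
def path (ω : ℕ × (ℕ → Icc (0 : ℝ) T)) : CountingPath T :=
  ⟨fun t => count {u : Icc (0 : ℝ) T | 0 < (u : ℝ) ∧ u ≤ t} ω, by
    intro t ht
    refine Finset.sum_eq_zero fun j _ => indicator_of_notMem ?_ _
    rintro ⟨h1, h2⟩
    exact (h1.trans_le h2).ne' ht, by
    intro s t hst
    refine Finset.sum_le_sum fun j _ => ?_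
    have hsub : {u : Icc (0 : ℝ) T | 0 < (u : ℝ) ∧ u ≤ s} ⊆
        {u : Icc (0 : ℝ) T | 0 < (u : ℝ) ∧ u ≤ t} := fun u hu => ⟨hu.1, hu.2.trans hst⟩
    exact indicator_le_indicator_of_subset hsub (fun _ => Nat.zero_le _) _, by
    intro t
    refine tendsto_finsetSum _ fun j _ => ?_
    refine tendsto_nhds_of_eventually_eq ?_
    -- Right-continuity: the contribution of each point is constant immediately to the right of `t`.
    rcases le_or_gt (ω.2 j) t with h | h
    · filter_upwards [self_mem_nhdsWithin] with s hs
      have hs' : ω.2 j ≤ s := h.trans hs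
      simp only [indicator_apply, mem_ofPred_eq, h, hs']
    · filter_upwards [mem_nhdsWithin_of_mem_nhds (Iio_mem_nhds h)] with s hs
      have hs' : ¬ ω.2 j ≤ s := not_le.2 hs
      simp only [indicator_apply, mem_ofPred_eq, hs', h.not_ge]⟩

lemma measurable_path : Measurable (path (T := T)) := by
  refine Measurable.subtype_mk (measurable_pi_lambda _ fun t => measurable_count ?_)
  exact (measurableSet_lt measurable_const measurable_subtype_coe).inter measurableSet_Iic

lemma path_sub (ω : ℕ × (ℕ → Icc (0 : ℝ) T)) {s t : Icc (0 : ℝ) T} (hst : s ≤ t) :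
    (path ω).1 t - (path ω).1 s = count (Ioc s t) ω := by
  have hU : {u : Icc (0 : ℝ) T | 0 < (u : ℝ) ∧ u ≤ t} =
      {u : Icc (0 : ℝ) T | 0 < (u : ℝ) ∧ u ≤ s} ∪ Ioc s t := by
    ext u
    simp only [mem_ofPred_eq, mem_union, mem_Ioc]
    constructor
    · rintro ⟨h1, h2⟩
      rcases le_or_gt u s with h | h
      exacts [Or.inl ⟨h1, h⟩, Or.inr ⟨h, h2⟩]
    · rintro (h | h)
      · exact ⟨h.1, h.2.trans hst⟩
      · exact ⟨s.2.1.trans_lt h.1, h.2⟩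
  have hd : Disjoint {u : Icc (0 : ℝ) T | 0 < (u : ℝ) ∧ u ≤ s} (Ioc s t) :=
    Set.disjoint_left.2 fun u hu hu' => (hu.2.trans_lt hu'.1).false
  simp only [path]
  rw [hU, count_union hd, Nat.add_sub_cancel_left]

end Paths

/-! ### The one-cold channel and its simulation -/

section Channel

variable {T : ℝ}

/-- Lebesgue measure on `[0,T]`. -/
abbrev leb (T : ℝ) : Measure (Icc (0 : ℝ) T) := volume.comap Subtype.val

lemma leb_univ : leb T univ = ENNReal.ofReal T := by
  rw [(MeasurableEmbedding.subtype_coe measurableSet_Icc).comap_apply, image_univ,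
    Subtype.range_coe, Real.volume_Icc, sub_zero]

instance : IsFiniteMeasure (leb T) := ⟨by rw [leb_univ]; exact ENNReal.ofReal_lt_top⟩

/-- The uniform distribution on `[0,T]`. -/
def unif (T : ℝ) : Measure (Icc (0 : ℝ) T) := (leb T)[|univ]

lemma leb_univ_ne_zero [hT : Fact (0 < T)] : leb T univ ≠ 0 := by
  rw [leb_univ]
  exact (ENNReal.ofReal_pos.2 hT.out).ne'

instance [Fact (0 < T)] : IsProbabilityMeasure (unif T) :=
  cond_isProbabilityMeasure leb_univ_ne_zero

/-- A Poisson number of mean `T` of uniform points has Lebesgue intensity, that is, rate one. -/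
lemma mul_unif_real [hT : Fact (0 < T)] (C : Set (Icc (0 : ℝ) T)) :
    (T.toNNReal : ℝ) * (unif T).real C = (leb T).real C := by
  have := hT.out
  rw [unif, Measure.real, cond_apply .univ, leb_univ, univ_inter, ENNReal.toReal_mul,
    ENNReal.toReal_inv, ENNReal.toReal_ofReal this.le, Real.coe_toNNReal _ this.le,
    mul_inv_cancel_left₀ this.ne', Measure.real]

lemma measurableSet_level {L : ℕ∞} (x : Input L T) (i : Band L) : MeasurableSet (x.1 ⁻¹' {i}) :=
  x.2 (measurableSet_singleton i)

lemma mean_zero_eq {L : ℕ∞} (x : Input L T) (i : Band L) (s t : Icc (0 : ℝ) T) :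
    (mean 0 x i s t : ℝ) = (leb T).real (Ioc s t \ x.1 ⁻¹' {i}) := by
  have hi : (fun τ => intensity 0 x i τ) = (x.1 ⁻¹' {i})ᶜ.indicator 1 := by
    ext τ
    by_cases h : x.1 τ = i <;> simp [intensity, h]
  rw [mean, hi, integral_indicator_one (measurableSet_level x i).compl,
    measureReal_restrict_apply (measurableSet_level x i).compl,
    Real.coe_toNNReal _ measureReal_nonneg, inter_comm, sdiff_eq]

variable [hT : Fact (0 < T)]

/-- One sample: independent rate-one Poisson processes in all bands. -/
def sampleLaw (L : ℕ∞) (T : ℝ) [Fact (0 < T)] :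
    Measure (Band L → ℕ × (ℕ → Icc (0 : ℝ) T)) :=
  Measure.infinitePi fun _ => poissonPoints T.toNNReal (unif T)

instance (L : ℕ∞) : IsProbabilityMeasure (sampleLaw L T) := by
  unfold sampleLaw; infer_instance

/-- The event that no point of a sample lies in the band that is blocked by `x` at that time. -/
def accept {L : ℕ∞} (x : Input L T) : Set (Band L → ℕ × (ℕ → Icc (0 : ℝ) T)) :=
  univ.pi fun i => avoid (x.1 ⁻¹' {i})

omit hT in
lemma measurableSet_accept {L : ℕ∞} (x : Input L T) : MeasurableSet (accept x) :=
  MeasurableSet.univ_pi fun i => measurableSet_avoid (measurableSet_level x i)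

lemma sampleLaw_accept {L : ℕ∞} (x : Input L T) :
    sampleLaw L T (accept x) = ENNReal.ofReal (Real.exp (-T)) := by
  have hsum : HasSum (fun i : Band L => -(leb T).real (x.1 ⁻¹' {i})) (-T) := by
    have h := measure_iUnion (μ := leb T) (f := fun i : Band L => x.1 ⁻¹' {i})
      (fun i j hij => Set.disjoint_left.2 fun u hu hu' => hij (hu.symm.trans hu'))
      (fun i => measurableSet_level x i)
    have hU : ⋃ i : Band L, x.1 ⁻¹' {i} = univ := by ext u; simp
    rw [hU, leb_univ] at h
    have h2 := ENNReal.hasSum_toReal (h ▸ ENNReal.ofReal_ne_top)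
    rw [← ENNReal.tsum_toReal_eq fun i => measure_ne_top _ _, ← h,
      ENNReal.toReal_ofReal hT.out.le] at h2
    exact h2.neg
  have hprod : HasProd
      (fun i : Band L => poissonPoints T.toNNReal (unif T) (avoid (x.1 ⁻¹' {i})))
      (ENNReal.ofReal (Real.exp (-T))) := by
    have := ENNReal.tendsto_ofReal hsum.rexp
    refine this.congr fun F => ?_
    simp only [Function.comp_apply]
    rw [ENNReal.ofReal_prod_of_nonneg fun i _ => (Real.exp_pos _).le]
    refine Finset.prod_congr rfl fun i _ => ?_
    rw [← mul_unif_real,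
      ← poissonPoints_real_avoid _ _ (measurableSet_level x i), ofReal_measureReal]
  rw [sampleLaw, accept, Measure.infinitePi_pi_univ _
    fun i => measurableSet_avoid (measurableSet_level x i), hprod.tprod_eq]

lemma sampleLaw_accept_ne_zero {L : ℕ∞} (x : Input L T) : sampleLaw L T (accept x) ≠ 0 := by
  rw [sampleLaw_accept]
  exact (ENNReal.ofReal_pos.2 (Real.exp_pos _)).ne'

/-- The output paths of a sample. -/
def paths {L : ℕ∞} (ω : Band L → ℕ × (ℕ → Icc (0 : ℝ) T)) : Output L T := fun i => path (ω i)

omit hT in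
lemma measurable_paths {L : ℕ∞} : Measurable (paths (L := L) (T := T)) :=
  measurable_pi_lambda _ fun i => measurable_path.comp (measurable_pi_apply i)

omit hT in
lemma measurable_increment (s t : Icc (0 : ℝ) T) :
    Measurable fun y : CountingPath T => y.1 t - y.1 s :=
  ((measurable_pi_apply t).comp measurable_subtype_coe).sub
    ((measurable_pi_apply s).comp measurable_subtype_coe)

/-- The output paths of an accepted sample follow the channel law. -/
lemma isChannelLaw_cond_accept {L : ℕ∞} (x : Input L T) :
    IsChannelLaw 0 x ((sampleLaw L T)[|accept x].map paths) := by
  set P := poissonPoints T.toNNReal (unif T)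
  have hB := measurableSet_level x
  have hprob (i : Band L) : IsProbabilityMeasure P[|avoid (x.1 ⁻¹' {i})] :=
    cond_isProbabilityMeasure (poissonPoints_avoid_ne_zero _ _ (hB i))
  -- Acceptance is a box, so conditioning acts band by band and preserves independence; its positive
  -- probability is what permits this for infinitely many bands.
  have hcond : (sampleLaw L T)[|accept x] =
      Measure.infinitePi fun i => P[|avoid (x.1 ⁻¹' {i})] :=
    infinitePi_cond_univ_pi _ (fun i => measurableSet_avoid (hB i)) (sampleLaw_accept_ne_zero x)
  have hprob' (i : Band L) : IsProbabilityMeasure (P[|avoid (x.1 ⁻¹' {i})].map path) :=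
    Measure.isProbabilityMeasure_map measurable_path.aemeasurable
  have hQ : (sampleLaw L T)[|accept x].map paths =
      Measure.infinitePi fun i => P[|avoid (x.1 ⁻¹' {i})].map path := by
    rw [hcond]
    exact Measure.infinitePi_map_pi _ fun _ => measurable_path
  rw [hQ]
  set Q := Measure.infinitePi fun i => P[|avoid (x.1 ⁻¹' {i})].map path
  have heval (i : Band L) : Q.map (fun y => y i) = P[|avoid (x.1 ⁻¹' {i})].map path :=
    Measure.infinitePi_map_eval _ i
  refine ⟨inferInstance, iIndepFun_infinitePi (X := fun _ => id) fun _ => measurable_id,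
    fun i n t ht => ?_, fun i s t hst => ?_⟩
  · rw [← iIndepFun_map_iff (P := Q) (φ := fun y : Output L T => y i) (measurable_pi_apply i)
      (X := fun (l : Fin n) y => y.1 (t l.succ) - y.1 (t l.castSucc))
      fun l => measurable_increment _ _, heval, iIndepFun_map_iff measurable_path
      fun l => measurable_increment _ _]
    simp_rw [path_sub _ (ht (Fin.castSucc_lt_succ).le)]
    refine iIndepFun_count_cond_avoid _ _ (fun l => measurableSet_Ioc) ?_ (hB i)
    refine (pairwise_disjoint_on _).2 fun k l hkl => ?_
    exact Set.disjoint_left.2 fun u hu hu' =>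
      ((hu.2.trans (ht (Fin.succ_le_castSucc_iff.2 hkl))).trans_lt hu'.1).false
  · refine ⟨((measurable_increment s t).comp (measurable_pi_apply i)).aemeasurable, ?_⟩
    have hc : (fun y : Output L T => (y i).1 t - (y i).1 s) =
      (fun y : CountingPath T => y.1 t - y.1 s) ∘ fun y => y i := rfl
    have hp : (fun y : CountingPath T => y.1 t - y.1 s) ∘ path = count (Ioc s t) := by
      ext ω
      exact path_sub ω hst.le
    rw [hc, ← Measure.map_map (measurable_increment s t) (measurable_pi_apply i), heval,
      Measure.map_map (measurable_increment s t) measurable_path, hp]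
    refine map_count_cond_avoid _ _ measurableSet_Ioc (hB i) ?_
    rw [mul_unif_real, mean_zero_eq]

/-- The rejection sampling scheme: the common randomness consists of `M` independent samples, and
the message is the index of the first accepted one. -/
def rejectionScheme (L : ℕ∞) (T : ℝ) [Fact (0 < T)] {M : ℕ} (k₀ : Fin M) : SimScheme L T M where
  W := Fin M → Band L → ℕ × (ℕ → Icc (0 : ℝ) T)
  law := Measure.pi fun _ => sampleLaw L T
  f w x := firstIndex k₀ (accept x) w
  measurable_f x := measurable_firstIndex k₀ (measurableSet_accept x)
  g w k := paths (w k)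
  measurable_g k := measurable_paths.comp (measurable_pi_apply k)

lemma simulable_rejection (L : ℕ∞) {M : ℕ} (hM : 1 ≤ M) :
    Simulable L 0 T M ((1 - Real.exp (-T)) ^ M) := by
  let k₀ : Fin M := ⟨0, hM⟩
  refine ⟨rejectionScheme L T k₀, fun x => ⟨_, isChannelLaw_cond_accept x, ?_⟩⟩
  have : Nonempty {A : Set (Output L T) // MeasurableSet A} := ⟨⟨∅, .empty⟩⟩
  refine ciSup_le fun ⟨A, hA⟩ => ?_
  have hK := measurable_firstIndex k₀ (measurableSet_accept x)
  have hmeas : Measurable fun w : Fin M → Band L → ℕ × (ℕ → Icc (0 : ℝ) T) =>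
      paths (w (firstIndex k₀ (accept x) w)) :=
    measurable_paths.comp
      -- The selected index is random, but takes finitely many values, so joint measurability
      -- reduces to each fixed index.
      ((measurable_from_prod_countable_left
        (f := fun q : (Fin M → Band L → ℕ × (ℕ → Icc (0 : ℝ) T)) × Fin M => q.1 q.2)
        fun k => measurable_pi_apply k).comp (measurable_id.prodMk hK))
  have h := abs_firstIndex_sub_cond_le (sampleLaw L T) k₀ (measurableSet_accept x)
    (measurable_paths hA) (sampleLaw_accept_ne_zero x)
  have hp : (sampleLaw L T).real (accept x) = Real.exp (-T) := by
    rw [Measure.real, sampleLaw_accept, ENNReal.toReal_ofReal (Real.exp_pos _).le]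
  rw [hp] at h
  rw [map_measureReal_apply measurable_paths hA]
  change |((Measure.pi fun _ : Fin M => sampleLaw L T).map
    fun w => paths (w (firstIndex k₀ (accept x) w))).real A - _| ≤ _
  rw [map_measureReal_apply hmeas hA]
  exact h

end Channel

end OCPC

end

/-! ### Bounds on the error and on the number of messages -/

theorem theorem4 (T : ℝ) (hT : 0 < T) :
    (∀ M : ℕ, 1 ≤ M →
      OCPC.epsSim ⊤ 0 T M ≤ ENNReal.ofReal ((1 - Real.exp (-T)) ^ M) ∧
      (1 - Real.exp (-T)) ^ M ≤ Real.exp (-(Real.exp (-T) * M))) ∧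
    (∀ ε : ℝ, 0 < ε → ε < 1 →
      ∃ m : ℕ, OCPC.Msim ⊤ 0 T ε = m ∧
        Real.log m ≤ max (T + Real.log (Real.log (1 / ε)) + Real.log 2) 0) := by
  have : Fact (0 < T) := ⟨hT⟩
  have hq : 0 ≤ 1 - Real.exp (-T) := by
    have := Real.exp_le_one_iff.2 (neg_nonpos.2 hT.le)
    linarith
  have hpow (M : ℕ) : (1 - Real.exp (-T)) ^ M ≤ Real.exp (-(Real.exp (-T) * M)) := by
    calc (1 - Real.exp (-T)) ^ M ≤ Real.exp (-Real.exp (-T)) ^ M :=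
          pow_le_pow_left₀ hq (Real.one_sub_le_exp_neg _) M
      _ = Real.exp (-(Real.exp (-T) * M)) := by
          rw [← Real.exp_nat_mul]
          ring_nf
  have hMsim (M : ℕ) (hM : 1 ≤ M) {ε : ℝ} (hε : (1 - Real.exp (-T)) ^ M ≤ ε) :
      OCPC.Msim ⊤ 0 T ε ≤ M := by
    obtain ⟨S, hS⟩ := OCPC.simulable_rejection (T := T) ⊤ hM
    refine iInf₂_le M ⟨hM, S, fun x => ?_⟩
    obtain ⟨Q, hQ, hle⟩ := hS x
    exact ⟨Q, hQ, hle.trans hε⟩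
  refine ⟨fun M hM => ⟨?_, hpow M⟩, fun ε hε0 hε1 => ?_⟩
  · refine (iInf₂_le ((1 - Real.exp (-T)) ^ M).toNNReal (hMsim M hM ?_)).trans le_rfl
    rw [Real.coe_toNNReal _ (pow_nonneg hq M)]
  · have hl : 0 < Real.log (1 / ε) := Real.log_pos (by rw [lt_div_iff₀ hε0]; linarith)
    -- Solves `exp(-e^{-T} a) = ε`, so `⌈a⌉₊` messages suffice.
    set a := Real.exp T * Real.log (1 / ε) with ha
    have ha0 : 0 < a := mul_pos (Real.exp_pos T) hl
    have hceil : 1 ≤ ⌈a⌉₊ := Nat.one_le_iff_ne_zero.2 (Nat.ceil_pos.2 ha0).ne'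
    have hle : OCPC.Msim ⊤ 0 T ε ≤ (⌈a⌉₊ : ℕ) := by
      refine hMsim _ hceil ((hpow _).trans ?_)
      rw [← Real.le_log_iff_exp_le hε0]
      have h1 : Real.exp (-T) * a ≤ Real.exp (-T) * ⌈a⌉₊ :=
        mul_le_mul_of_nonneg_left (Nat.le_ceil a) (Real.exp_pos _).le
      have h2 : Real.exp (-T) * a = -Real.log ε := by
        rw [ha, ← mul_assoc, ← Real.exp_add, neg_add_cancel, Real.exp_zero, one_mul, one_div,
          Real.log_inv]
      linarith
    obtain ⟨m, hm⟩ := ENat.ne_top_iff_exists.1 (hle.trans_lt (ENat.natCast_lt_top _)).ne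
    rw [← hm, Nat.cast_le] at hle
    refine ⟨m, hm.symm, ?_⟩
    -- The case `m = 0` is harmless because `Real.log 0 = 0`.
    rcases Nat.eq_zero_or_pos m with rfl | hm0
    · simp
    have hlog : Real.log m ≤ Real.log ⌈a⌉₊ :=
      Real.log_le_log (by exact_mod_cast hm0) (by exact_mod_cast hle)
    refine hlog.trans ?_
    -- If `a ≤ 1`, one message suffices, which is the `0` in the maximum. Otherwise `⌈a⌉₊ < a + 1 <
    -- 2a`, the source of `ln 2`.
    rcases le_or_gt a 1 with h1 | h1
    · have : ⌈a⌉₊ = 1 := le_antisymm (Nat.ceil_le.2 (by simpa using h1)) hceil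
      simp [this]
    · refine le_max_of_le_left ?_
      have h2 : (⌈a⌉₊ : ℝ) ≤ a * 2 := by
        have := Nat.ceil_lt_add_one ha0.le
        linarith
      calc Real.log ⌈a⌉₊ ≤ Real.log (a * 2) :=
            Real.log_le_log (by exact_mod_cast hceil) h2
        _ = T + Real.log (Real.log (1 / ε)) + Real.log 2 := by
            rw [Real.log_mul ha0.ne' two_ne_zero, ha, Real.log_mul (Real.exp_pos T).ne' hl.ne',
              Real.log_exp]
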